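/- For a finite group $K$ and $n\ge 0$, let $\beta_{K,n}$ be the number of orbits of $K$, acting by simultaneous conjugation $g\cdot(x_1,\dots,x_n)=(gx_1g^{-1},\dots,gx_ng^{-1})$, on the set of $n$-tuples of pairwise commuting elements of $K$, and let $B_K(t)=\sum_{n\ge 0}\beta_{K,n}t^n\in\mathbb{Q}[[t]]$. Let $G$ be a finite Frobenius group with Frobenius complement $H$ and Frobenius kernel $N$; that is, $H$ is a proper non-trivial subgroup of $G$ with $H\cap gHg^{-1}=\{1\}$ for all $g\in G\setminus H$, and $N$ is the subgroup of $G$ whose underlying set is $\bigl(G\setminus\bigcup_{g\in G}gHg^{-1}\bigr)\cup\{1\}$. Then $$(1-t)B_G(t)=1+\frac{1}{|H|}\Bigl((1-t)B_N(t)-1\Bigr)+\Bigl((1-t)B_H(t)-1\Bigr).$$ -/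

import Mathlib

/-!
Removing the trivial tuple, a commuting tuple of a Frobenius group lives in exactly one of the
subgroups `N` and `gHg⁻¹`, because these subgroups partition `G` and contain the centralizers of
their nontrivial elements. By Burnside's lemma `|K| β_{K,n}` is the number of commuting
`(n + 1)`-tuples of `K`, so for any such partition `|G| (β_{G,n} - 1) = ∑ |K| (β_{K,n} - 1)`, the
sum being over its members `K`. In the Frobenius case the conjugates of `H` contribute
`|G : H| |H| (β_{H,n} - 1)`, and `|N| = |G : H|`.
-/

open scoped PowerSeries

namespace FrobGen

/-- The set `G^(n)` of `n`-tuples of pairwise commuting elements of `G`. -/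
def CommutingTuple (G : Type*) [Group G] (n : ℕ) : Type _ :=
  {x : Fin n → G // ∀ i j, Commute (x i) (x j)}

/-- `G` acts on `G^(n)` by simultaneous conjugation. -/
instance conjAction (G : Type*) [Group G] (n : ℕ) : MulAction G (CommutingTuple G n) where
  smul g x := ⟨fun i => g * x.1 i * g⁻¹, fun i j => by
    simpa using (x.2 i j).map (MulAut.conj g)⟩
  one_smul x := Subtype.ext (funext fun i => by
    change 1 * x.1 i * 1⁻¹ = x.1 i
    simp)
  mul_smul g h x := Subtype.ext (funext fun i => by
    change g * h * x.1 i * (g * h)⁻¹ = g * (h * x.1 i * h⁻¹) * g⁻¹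
    group)

/-- The number of simultaneous conjugacy classes of commuting `n`-tuples in `G`. -/
noncomputable def beta (G : Type*) [Group G] (n : ℕ) : ℕ :=
  Nat.card (MulAction.orbitRel.Quotient G (CommutingTuple G n))

/-- The generating function `B_G(t) = ∑ n, β_{G,n} t ^ n`, as a formal power series. -/
noncomputable def B (G : Type*) [Group G] : ℚ⟦X⟧ :=
  PowerSeries.mk fun n => (beta G n : ℚ)

/-- The conjugate subgroup `g H g⁻¹`. -/
def conjSubgroup {G : Type*} [Group G] (g : G) (H : Subgroup G) : Subgroup G :=
  H.map (MulAut.conj g).toMonoidHom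

/-- `H` is a Frobenius complement of `G`: a proper nontrivial subgroup with
`H ∩ g H g⁻¹ = {1}` for all `g ∈ G \ H`. -/
structure IsFrobeniusComplement {G : Type*} [Group G] (H : Subgroup G) : Prop where
  ne_bot : H ≠ ⊥
  ne_top : H ≠ ⊤
  inf_conj : ∀ g : G, g ∉ H → H ⊓ conjSubgroup g H = ⊥

/-- The subset `(G \ ⋃ g, g H g⁻¹) ∪ {1}` of `G`, the Frobenius kernel with respect to `H`. -/
def frobeniusKernel {G : Type*} [Group G] (H : Subgroup G) : Set G :=
  (Set.univ \ ⋃ g : G, (conjSubgroup g H : Set G)) ∪ {1}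

end FrobGen

namespace FrobGen

namespace CommutingTuple

variable {G K : Type*} [Group G] [Group K] {n : ℕ}

instance [Finite G] : Finite (CommutingTuple G n) :=
  inferInstanceAs (Finite {x : Fin n → G // ∀ i j, Commute (x i) (x j)})

instance : One (CommutingTuple G n) :=
  ⟨⟨1, fun _ _ => Commute.refl 1⟩⟩

theorem ne_one_iff_exists {x : CommutingTuple G n} : x ≠ 1 ↔ ∃ i, x.1 i ≠ 1 :=
  Subtype.coe_ne_coe.symm.trans Function.ne_iff

/-- The image of a commuting tuple under a group homomorphism. -/
def map (f : G →* K) (x : CommutingTuple G n) : CommutingTuple K n :=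
  ⟨fun i => f (x.1 i), fun i j => (x.2 i j).map f⟩

theorem map_injective {f : G →* K} (hf : Function.Injective f) :
    Function.Injective (map (n := n) f) := fun _ _ h =>
  Subtype.ext (hf.comp_left (congrArg Subtype.val h))

protected theorem map_one (f : G →* K) : map (n := n) f 1 = 1 :=
  Subtype.ext (funext fun _ => f.map_one)

protected theorem map_smul (f : G →* K) (g : G) (x : CommutingTuple G n) :
    map f (g • x) = f g • map f x :=
  Subtype.ext (funext fun i => by
    change f (g * x.1 i * g⁻¹) = f g * f (x.1 i) * (f g)⁻¹
    simp only [map_mul, map_inv])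

theorem exists_map_subtype_eq {H : Subgroup G} {x : CommutingTuple G n} (hx : ∀ i, x.1 i ∈ H) :
    ∃ y, map H.subtype y = x :=
  ⟨⟨fun i => ⟨x.1 i, hx i⟩, fun i j => Subtype.ext (x.2 i j)⟩, rfl⟩

/-- Isomorphic groups have equivalent sets of commuting tuples. -/
def congr (e : G ≃* K) (n : ℕ) : CommutingTuple G n ≃ CommutingTuple K n where
  toFun := map e
  invFun := map e.symm
  left_inv x := Subtype.ext (funext fun i => e.symm_apply_apply (x.1 i))
  right_inv x := Subtype.ext (funext fun i => e.apply_symm_apply (x.1 i))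

theorem mem_fixedBy_iff {g : G} {x : CommutingTuple G n} :
    x ∈ MulAction.fixedBy (CommutingTuple G n) g ↔ ∀ i, Commute g (x.1 i) := by
  rw [MulAction.mem_fixedBy]
  refine (Subtype.ext_iff.trans funext_iff).trans (forall_congr' fun i => ?_)
  exact mul_inv_eq_iff_eq_mul

/-- A commuting `n`-tuple centralized by `g` is a commuting `(n + 1)`-tuple with head `g`. -/
def sigmaFixedByEquiv (G : Type*) [Group G] (n : ℕ) :
    (Σ g : G, MulAction.fixedBy (CommutingTuple G n) g) ≃ CommutingTuple G (n + 1) where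
  toFun p := ⟨Fin.cons p.1 p.2.1.1, by
    have h := mem_fixedBy_iff.1 p.2.2
    exact Fin.cases (Fin.cases (Commute.refl _) h) fun i =>
      Fin.cases (h i).symm (p.2.1.2 i)⟩
  invFun x := ⟨x.1 0, ⟨Fin.tail x.1, fun i j => x.2 i.succ j.succ⟩,
    mem_fixedBy_iff.2 fun i => x.2 0 i.succ⟩
  left_inv _ := rfl
  right_inv x := Subtype.ext (Fin.cons_self_tail x.1)

theorem card_succ (G : Type*) [Group G] (n : ℕ) :
    Nat.card (CommutingTuple G (n + 1)) = Nat.card G * beta G n :=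
  calc
    _ = Nat.card (Σ g : G, MulAction.fixedBy (CommutingTuple G n) g) :=
      (Nat.card_congr (sigmaFixedByEquiv G n)).symm
    _ = Nat.card (MulAction.orbitRel.Quotient G (CommutingTuple G n) × G) :=
      Nat.card_congr (MulAction.sigmaFixedByEquivOrbitsProdGroup G (CommutingTuple G n))
    _ = Nat.card G * beta G n := (Nat.card_prod _ _).trans (mul_comm _ _)

theorem card_one (G : Type*) [Group G] : Nat.card (CommutingTuple G 1) = Nat.card G :=
  Nat.card_congr
    { toFun := fun x => x.1 0
      invFun := fun g => ⟨fun _ => g, fun _ _ => Commute.refl g⟩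
      left_inv := fun x => Subtype.ext (funext fun i => by rw [Subsingleton.elim i 0])
      right_inv := fun _ => rfl }

theorem card_ne_one_add_one (G : Type*) [Group G] [Finite G] (n : ℕ) :
    Nat.card {x : CommutingTuple G n // x ≠ 1} + 1 = Nat.card (CommutingTuple G n) := by
  classical
  rw [← Finite.card_option, Nat.card_congr (Equiv.optionSubtypeNe 1)]

end CommutingTuple

theorem beta_congr {G K : Type*} [Group G] [Group K] (e : G ≃* K) (n : ℕ) :
    beta G n = beta K n := by
  refine Nat.card_congr (Quotient.congr (CommutingTuple.congr e n) fun x y => ?_)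
  change (∃ g : G, g • y = x) ↔
    ∃ k : K, k • CommutingTuple.map (e : G →* K) y = CommutingTuple.map (e : G →* K) x
  refine Iff.trans (exists_congr fun g => ?_) e.surjective.exists.symm
  rw [← (CommutingTuple.congr e n).injective.eq_iff]
  exact Eq.congr_left (CommutingTuple.map_smul (e : G →* K) g y)

/-- A CC-subgroup: it contains the centralizer of each of its nontrivial elements. -/
def IsCCSubgroup {G : Type*} [Group G] (H : Subgroup G) : Prop :=
  ∀ ⦃x y : G⦄, x ∈ H → x ≠ 1 → Commute x y → y ∈ H

/-- A partition of a group into CC-subgroups: every nontrivial element lies in exactly one of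
them. Some members of the family may be trivial. -/
structure IsCCPartition {G ι : Type*} [Group G] (K : ι → Subgroup G) : Prop where
  existsUnique_mem : ∀ x : G, x ≠ 1 → ∃! i, x ∈ K i
  isCCSubgroup : ∀ i, IsCCSubgroup (K i)

namespace IsCCPartition

open CommutingTuple

variable {G ι : Type*} [Group G] {K : ι → Subgroup G}

theorem existsUnique_map_subtype_eq (hK : IsCCPartition K) {n : ℕ} {x : CommutingTuple G n}
    (hx : x ≠ 1) : ∃! i, ∃ y : CommutingTuple (K i) n, map (K i).subtype y = x := by
  obtain ⟨k, hk⟩ := ne_one_iff_exists.1 hx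
  obtain ⟨i, hi, hunique⟩ := hK.existsUnique_mem _ hk
  refine ⟨i, exists_map_subtype_eq fun j => hK.isCCSubgroup i hi hk (x.2 k j), ?_⟩
  rintro j ⟨y, rfl⟩
  exact hunique j (y.1 k).2

theorem card_ne_one [Finite G] [Fintype ι] (hK : IsCCPartition K) (n : ℕ) :
    Nat.card {x : CommutingTuple G n // x ≠ 1} =
      ∑ i, Nat.card {x : CommutingTuple (K i) n // x ≠ 1} := by
  have map_ne_one (i : ι) {x : CommutingTuple (K i) n} (hx : x ≠ 1) :
      map (K i).subtype x ≠ 1 :=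
    ((map_injective (K i).subtype_injective).ne hx).trans_eq (CommutingTuple.map_one _)
  let toTuple (p : Σ i, {x : CommutingTuple (K i) n // x ≠ 1}) :
      {x : CommutingTuple G n // x ≠ 1} := ⟨map (K p.1).subtype p.2.1, map_ne_one p.1 p.2.2⟩
  have injective : Function.Injective toTuple := by
    rintro ⟨i, x, hx⟩ ⟨j, y, hy⟩ hxy
    have hxy : map (K i).subtype x = map (K j).subtype y := congrArg Subtype.val hxy
    obtain rfl : i = j :=
      (hK.existsUnique_map_subtype_eq (map_ne_one i hx)).unique ⟨x, rfl⟩ ⟨y, hxy.symm⟩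
    obtain rfl := map_injective (K i).subtype_injective hxy
    rfl
  have surjective : Function.Surjective toTuple := by
    rintro ⟨x, hx⟩
    obtain ⟨i, y, rfl⟩ := (hK.existsUnique_map_subtype_eq hx).exists
    exact ⟨⟨i, y, fun hy => hx (hy ▸ CommutingTuple.map_one _)⟩, rfl⟩
  rw [← Nat.card_congr (Equiv.ofBijective toTuple ⟨injective, surjective⟩), Nat.card_sigma]

theorem card_commutingTuple_sub_one [Finite G] [Fintype ι] (hK : IsCCPartition K) (n : ℕ) :
    (Nat.card (CommutingTuple G n) : ℚ) - 1 =
      ∑ i, ((Nat.card (CommutingTuple (K i) n) : ℚ) - 1) := by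
  simp only [← card_ne_one_add_one, hK.card_ne_one, Nat.cast_add, Nat.cast_one,
    add_sub_cancel_right, Nat.cast_sum]

theorem card_sub_one [Finite G] [Fintype ι] (hK : IsCCPartition K) :
    (Nat.card G : ℚ) - 1 = ∑ i, ((Nat.card (K i) : ℚ) - 1) := by
  simpa only [card_one] using hK.card_commutingTuple_sub_one 1

theorem card_mul_beta_sub_one [Finite G] [Fintype ι] (hK : IsCCPartition K) (n : ℕ) :
    (Nat.card G : ℚ) * (beta G n - 1) = ∑ i, (Nat.card (K i) : ℚ) * (beta (K i) n - 1) := by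
  have h := hK.card_commutingTuple_sub_one (n + 1)
  simp only [card_succ, Nat.cast_mul] at h
  calc
    (Nat.card G : ℚ) * (beta G n - 1) = (Nat.card G * beta G n - 1) - (Nat.card G - 1) := by ring
    _ = ∑ i, (((Nat.card (K i) : ℚ) * beta (K i) n - 1) - (Nat.card (K i) - 1)) := by
      rw [h, hK.card_sub_one, ← Finset.sum_sub_distrib]
    _ = ∑ i, (Nat.card (K i) : ℚ) * (beta (K i) n - 1) :=
      Finset.sum_congr rfl fun i _ => by ring

end IsCCPartition

section Frobenius

variable {G : Type*} [Group G] {N H : Subgroup G}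

theorem mem_conjSubgroup {g x : G} : x ∈ conjSubgroup g H ↔ g⁻¹ * x * g ∈ H :=
  Subgroup.mem_map_equiv.trans (by rw [MulAut.conj_symm_apply])

theorem card_conjSubgroup (g : G) (H : Subgroup G) : Nat.card (conjSubgroup g H) = Nat.card H :=
  Subgroup.card_map_of_injective (MulAut.conj g).injective

theorem beta_conjSubgroup (g : G) (H : Subgroup G) (n : ℕ) :
    beta (conjSubgroup g H) n = beta H n :=
  (beta_congr (H.equivMapOfInjective _ (MulAut.conj g).injective) n).symm

theorem conjSubgroup_eq_of_inv_mul_mem {a b : G} (h : a⁻¹ * b ∈ H) :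
    conjSubgroup a H = conjSubgroup b H := by
  ext x
  rw [mem_conjSubgroup, mem_conjSubgroup, ← Subgroup.mul_mem_cancel_right H h,
    ← Subgroup.mul_mem_cancel_left H (H.inv_mem h)]
  group

/-- A malnormal subgroup: it meets its conjugates by outside elements trivially. Frobenius
complements are the malnormal subgroups that are proper and nontrivial. -/
def IsMalnormal (H : Subgroup G) : Prop :=
  ∀ g ∉ H, H ⊓ conjSubgroup g H = ⊥

theorem IsMalnormal.inv_mul_mem (hH : IsMalnormal H) {a b x : G} (hx : x ≠ 1)
    (ha : x ∈ conjSubgroup a H) (hb : x ∈ conjSubgroup b H) : a⁻¹ * b ∈ H := by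
  by_contra hab
  have hmem : a⁻¹ * x * a ∈ H ⊓ conjSubgroup (a⁻¹ * b) H := by
    refine ⟨mem_conjSubgroup.1 ha, mem_conjSubgroup.2 ?_⟩
    simpa [mul_assoc] using mem_conjSubgroup.1 hb
  rw [hH _ hab, Subgroup.mem_bot] at hmem
  exact hx (by simpa [mul_assoc, inv_mul_eq_one, eq_comm] using hmem)

theorem IsMalnormal.isCCSubgroup_conjSubgroup (hH : IsMalnormal H) (g : G) :
    IsCCSubgroup (conjSubgroup g H) := fun x y hx hx1 hxy => by
  -- Conjugation by `y` fixes `x`, so `x` lies in the conjugates of `H` by both `g` and `y * g`.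
  have hxyg : x ∈ conjSubgroup (y * g) H := by
    have hy : y⁻¹ * x * y = x := by rw [mul_assoc, hxy.eq, inv_mul_cancel_left]
    rw [mem_conjSubgroup] at hx ⊢
    rwa [← hy, ← mul_assoc, ← mul_assoc, ← mul_inv_rev, mul_assoc _ y g] at hx
  rw [mem_conjSubgroup, mul_assoc]
  exact hH.inv_mul_mem hx1 hx hxyg

theorem mem_kernel_iff_of_ne_one (hN : (N : Set G) = frobeniusKernel H) {x : G} (hx : x ≠ 1) :
    x ∈ N ↔ ∀ g, x ∉ conjSubgroup g H := by
  rw [← SetLike.mem_coe, hN]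
  simp [frobeniusKernel, hx]

theorem IsMalnormal.isCCSubgroup_kernel (hH : IsMalnormal H)
    (hN : (N : Set G) = frobeniusKernel H) : IsCCSubgroup N := fun x y hx hx1 hxy => by
  rcases eq_or_ne y 1 with rfl | hy1
  · exact N.one_mem
  rw [mem_kernel_iff_of_ne_one hN hx1] at hx
  rw [mem_kernel_iff_of_ne_one hN hy1]
  exact fun g hy => hx g (hH.isCCSubgroup_conjSubgroup g hy hy1 hxy.symm)

/-- The Frobenius partition: the kernel `N`, at index `none`, and the conjugates of the
complement `H`, indexed by the left cosets of `H` because `gHg⁻¹` depends only on `gH`. -/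
def frobeniusPartition (N H : Subgroup G) : Option (G ⧸ H) → Subgroup G
  | none => N
  | some c => Quotient.liftOn' c (conjSubgroup · H) fun _ _ h =>
      conjSubgroup_eq_of_inv_mul_mem (QuotientGroup.leftRel_apply.1 h)

theorem IsMalnormal.isCCPartition_frobeniusPartition (hH : IsMalnormal H)
    (hN : (N : Set G) = frobeniusKernel H) : IsCCPartition (frobeniusPartition N H) where
  existsUnique_mem x hx := by
    have hxN := mem_kernel_iff_of_ne_one hN hx
    by_cases h : x ∈ N
    · refine ⟨none, h, ?_⟩
      rintro (_ | ⟨⟨g⟩⟩) hg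
      · rfl
      · exact absurd hg (hxN.1 h g)
    · obtain ⟨a, ha⟩ : ∃ a, x ∈ conjSubgroup a H := by simpa [hxN] using h
      refine ⟨some a, ha, ?_⟩
      rintro (_ | ⟨⟨b⟩⟩) hb
      · exact absurd hb h
      · exact congrArg some (QuotientGroup.eq.2 (hH.inv_mul_mem hx hb ha))
  isCCSubgroup := by
    rintro (_ | ⟨⟨g⟩⟩)
    · exact hH.isCCSubgroup_kernel hN
    · exact hH.isCCSubgroup_conjSubgroup g

theorem sum_frobeniusPartition [Fintype (G ⧸ H)] {M : Type*} [AddCommMonoid M] (N : Subgroup G)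
    {f : Subgroup G → M} (hf : ∀ g, f (conjSubgroup g H) = f H) :
    ∑ i, f (frobeniusPartition N H i) = f N + H.index • f H := by
  have hcoset (c : G ⧸ H) : f (frobeniusPartition N H (some c)) = f H := by
    obtain ⟨g⟩ := c
    exact hf g
  rw [Fintype.sum_option, Fintype.sum_congr _ _ hcoset, Finset.sum_const, Finset.card_univ,
    ← Nat.card_eq_fintype_card, ← H.index_eq_card]
  rfl

theorem IsMalnormal.card_kernel [Finite G] (hH : IsMalnormal H)
    (hN : (N : Set G) = frobeniusKernel H) : Nat.card N = H.index := by
  have := Fintype.ofFinite (G ⧸ H)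
  have hsum : (Nat.card G : ℚ) - 1 = (Nat.card N - 1) + H.index • ((Nat.card H : ℚ) - 1) :=
    (hH.isCCPartition_frobeniusPartition hN).card_sub_one.trans
      (sum_frobeniusPartition (f := fun K => (Nat.card K : ℚ) - 1) N
        fun g => by rw [card_conjSubgroup])
  have hG : (Nat.card H : ℚ) * H.index = Nat.card G := mod_cast H.card_mul_index
  rw [nsmul_eq_mul] at hsum
  have hcard : (Nat.card N : ℚ) = H.index := by linear_combination -hsum - hG
  exact_mod_cast hcard

theorem IsMalnormal.beta_sub_one [Finite G] (hH : IsMalnormal H)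
    (hN : (N : Set G) = frobeniusKernel H) (n : ℕ) :
    (beta G n : ℚ) - 1 = 1 / Nat.card H * (beta N n - 1) + (beta H n - 1) := by
  have := Fintype.ofFinite (G ⧸ H)
  have hsum : (Nat.card G : ℚ) * (beta G n - 1) =
      Nat.card N * (beta N n - 1) + H.index • ((Nat.card H : ℚ) * (beta H n - 1)) :=
    ((hH.isCCPartition_frobeniusPartition hN).card_mul_beta_sub_one n).trans
      (sum_frobeniusPartition (f := fun K => (Nat.card K : ℚ) * (beta K n - 1)) N
        fun g => by rw [card_conjSubgroup, beta_conjSubgroup])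
  rw [hH.card_kernel hN, ← H.card_mul_index, nsmul_eq_mul, Nat.cast_mul] at hsum
  have hcard : (Nat.card H : ℚ) ≠ 0 := Nat.cast_ne_zero.2 Nat.card_pos.ne'
  have hindex : (H.index : ℚ) ≠ 0 := Nat.cast_ne_zero.2 H.index_ne_zero_of_finite
  field_simp
  exact mul_left_cancel₀ hindex (by linear_combination hsum)

end Frobenius

theorem one_sub_X_mul_B_sub_one (G : Type*) [Group G] :
    (1 - PowerSeries.X) * B G - 1 =
      (1 - PowerSeries.X) * PowerSeries.mk fun n => (beta G n : ℚ) - 1 := by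
  have hmk : PowerSeries.mk (fun n => (beta G n : ℚ) - 1) = B G - PowerSeries.mk 1 := rfl
  rw [hmk, mul_sub, mul_comm _ (PowerSeries.mk 1), PowerSeries.mk_one_mul_one_sub_eq_one]

end FrobGen

theorem theorem9p3 {G : Type*} [Group G] [Finite G] (N H : Subgroup G)
    (hH : FrobGen.IsFrobeniusComplement H)
    (hN : (N : Set G) = FrobGen.frobeniusKernel H) :
    (1 - PowerSeries.X) * FrobGen.B G =
      1 + PowerSeries.C (1 / (Nat.card H : ℚ)) * ((1 - PowerSeries.X) * FrobGen.B N - 1)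
        + ((1 - PowerSeries.X) * FrobGen.B H - 1) := by
  have hmalnormal : FrobGen.IsMalnormal H := hH.inf_conj
  have hbeta : (PowerSeries.mk fun n => (FrobGen.beta G n : ℚ) - 1) =
      PowerSeries.C (1 / (Nat.card H : ℚ)) * (PowerSeries.mk fun n => (FrobGen.beta N n : ℚ) - 1) +
        PowerSeries.mk fun n => (FrobGen.beta H n : ℚ) - 1 := by
    ext n
    simpa only [map_add, PowerSeries.coeff_C_mul, PowerSeries.coeff_mk] using
      hmalnormal.beta_sub_one hN n
  rw [FrobGen.one_sub_X_mul_B_sub_one N, FrobGen.one_sub_X_mul_B_sub_one H]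
  linear_combination FrobGen.one_sub_X_mul_B_sub_one G + (1 - PowerSeries.X) * hbeta
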